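/- For every integer $k\ge 3$ and every real $\mu\in\left(0,\frac{k-1}{k}\right)$ there is a set of natural numbers $X\subseteq\mathbb{N}$ such that (i) for every integer $r\ge 1$, every colouring of $X$ with $r$ colours contains a monochromatic arithmetic progression of length $k$, that is, there are natural numbers $a$ and $d\ge 1$ such that $a, a+d, \dots, a+(k-1)d$ all belong to $X$ and have the same colour; and (ii) every finite subset $Y\subseteq X$ has a subset $Z\subseteq Y$ with $|Z|\ge\mu|Y|$ that contains no arithmetic progression $a, a+d, \dots, a+(k-1)d$ of length $k$ with $d\ge 1$. -/

import Mathlib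

/-- The set `S` of natural numbers contains an arithmetic progression of length `k` with nonzero
common difference, i.e. the `k` distinct numbers `a, a + d, …, a + (k - 1) d` for some `d > 0`. -/
def ContainsAP (k : ℕ) (S : Set ℕ) : Prop :=
  ∃ a d : ℕ, 0 < d ∧ ∀ i < k, a + i * d ∈ S

/-- The van der Waerden property: every colouring of `X` with `r` colours has a colour class
that contains an arithmetic progression of length `k`. -/
def VanDerWaerdenProperty (k r : ℕ) (X : Set ℕ) : Prop :=
  ∀ c : X → Fin r, ∃ j : Fin r, ContainsAP k {x : ℕ | ∃ hx : x ∈ X, c ⟨x, hx⟩ = j}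

/-! It suffices to find, for each number `r` of colours, a finite set with both properties.
Translating these sets into short blocks that are far apart gives a union in which every progression
of length `k` stays in one block (`exists_block_of_AP`), so both properties pass to the union.

For fixed `r`, the source is an abstract `k`-uniform hypergraph that is Ramsey for `r` colours,
although a random member of a suitable family of vertex covers contains each vertex with probability
only slightly above `1 / k` (`exists_ramsey_hypergraph`). Complements of covers contain no edge, and
by averaging one of them keeps the proportion `μ` of any given finite set lying over the vertices.

It remains to turn edges into progressions without creating unrelated ones. A product with a
Hales–Jewett cube provides integer levels (`exists_levelled_system`). The partite construction then
gives a faithful system above it (`exists_faithful_system`), and a generic edge-respecting function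
embeds that system in the natural numbers (`Faithful.exists_nat_embedding`). Every nonconstant
progression of length `k` in the image contains the image of an edge, so deleting the points above a
vertex cover destroys all of them. -/

open Combinatorics

/-! ### Progressions and faithful systems -/

/-- `s` lists the terms of an arithmetic progression of integers; constant ones are allowed. -/
def IsAP {k : ℕ} (s : Fin k → ℤ) : Prop := ∃ a d : ℤ, ∀ i, s i = a + (i : ℤ) * d

/-- `g` turns every edge of the system `E` into an arithmetic progression. -/
def IsAPFun {k : ℕ} {P : Type} (E : Set (Fin k → P)) (g : P → ℤ) : Prop :=
  ∀ e ∈ E, IsAP (fun i => g (e i))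

/-- A tuple that all functions respecting the edges of `E` map to arithmetic progressions is
constant or passes through all points of an edge. -/
def Faithful {k : ℕ} {P : Type} (E : Set (Fin k → P)) : Prop :=
  ∀ x : Fin k → P, (∀ g, IsAPFun E g → IsAP (fun i => g (x i))) →
    (∀ i j, x i = x j) ∨ ∃ e ∈ E, Set.range e ⊆ Set.range x

lemma isAP_const {k : ℕ} (a : ℤ) : IsAP (fun _ : Fin k => a) := ⟨a, 0, by simp⟩

lemma IsAP.sub_const {k : ℕ} {s : Fin k → ℤ} (h : IsAP s) (b : ℤ) :
    IsAP (fun i => s i - b) := by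
  obtain ⟨a, d, h⟩ := h
  exact ⟨a - b, d, fun i => by simp only [h i]; ring⟩

/-- Two arithmetic progressions that agree in two places are equal. -/
lemma IsAP.eq_of_eq {k : ℕ} {s t : Fin k → ℤ} (hs : IsAP s) (ht : IsAP t) {i j : Fin k}
    (hij : i ≠ j) (hi : s i = t i) (hj : s j = t j) : s = t := by
  obtain ⟨a, d, hs⟩ := hs
  obtain ⟨b, e, ht⟩ := ht
  have hij' : ((i : ℕ) : ℤ) - ((j : ℕ) : ℤ) ≠ 0 := by
    have : (i : ℕ) ≠ j := fun h => hij (Fin.ext h)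
    omega
  have hde : d = e := by
    rw [hs, ht] at hi hj
    have : (((i : ℕ) : ℤ) - ((j : ℕ) : ℤ)) * (d - e) = 0 := by linear_combination hi - hj
    rcases mul_eq_zero.1 this with h | h
    · exact absurd h hij'
    · linarith
  subst hde
  rw [hs, ht] at hi
  funext l
  rw [hs, ht]
  linarith

lemma exists_two_ne {k : ℕ} (hk : 3 ≤ k) (j : Fin k) :
    ∃ a b : Fin k, a ≠ j ∧ b ≠ j ∧ a ≠ b := by
  have h : 1 < (Finset.univ.erase j).card := by
    rw [Finset.card_erase_of_mem (Finset.mem_univ _), Finset.card_univ, Fintype.card_fin]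
    omega
  obtain ⟨a, ha, b, hb, hab⟩ := Finset.one_lt_card.1 h
  exact ⟨a, b, Finset.ne_of_mem_erase ha, Finset.ne_of_mem_erase hb, hab⟩

/-! ### Base of the partite construction -/

section Disjoint

variable {k : ℕ} {V : Type} (EG : Set (Fin k → V))

/-- The edge system consisting of one disjoint copy of every edge of `EG`. -/
def disjointEdges : Set (Fin k → EG × Fin k) := {e | ∃ f : EG, e = fun i => (f, i)}

/-- The indicator of one copy respects all edges, and a progression of at least three terms with
values in {0, 1} is constant, so the tuple stays in one copy. There the position along the edge
respects edges, and it is constant or bijective on the tuple. -/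
lemma faithful_disjointEdges (hk : 3 ≤ k) : Faithful (disjointEdges EG) := by
  classical
  intro x hx
  have hsame : ∀ i, (x i).1 = (x ⟨0, by omega⟩).1 := by
    set f := (x ⟨0, by omega⟩).1 with hf
    have h1 := hx (fun p => if p.1 = f then 1 else 0) (by
      rintro _ ⟨f', rfl⟩
      exact isAP_const (if f' = f then 1 else 0))
    obtain ⟨a, d, h⟩ := h1
    beta_reduce at h
    have h0 := h ⟨0, by omega⟩
    have h1 := h ⟨1, by omega⟩
    have h2 := h ⟨2, by omega⟩
    simp only [← hf, if_true] at h0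
    have hd : d = 0 := by
      split_ifs at h1 h2 <;> push_cast at h0 h1 h2 <;> omega
    intro i
    have hi := h i
    by_contra hne
    rw [if_neg hne] at hi
    push_cast at h0
    subst hd
    omega
  have h2 := hx (fun p => (p.2 : ℤ)) (by
    rintro _ ⟨f', rfl⟩
    exact ⟨0, 1, fun i => by simp⟩)
  obtain ⟨a, d, h⟩ := h2
  beta_reduce at h
  by_cases hd : d = 0
  · left
    intro i j
    refine Prod.ext (by rw [hsame i, hsame j]) ?_
    have hi := h i
    have hj := h j
    rw [hd, mul_zero] at hi hj
    apply Fin.ext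
    omega
  · right
    refine ⟨fun i => ((x ⟨0, by omega⟩).1, i), ⟨_, rfl⟩, ?_⟩
    have hinj : Function.Injective (fun i => (x i).2) := by
      intro i j hij
      have hij' : ((x i).2 : ℤ) = ((x j).2 : ℤ) := by
        simp only at hij; rw [hij]
      have : (((i : ℕ) : ℤ) - ((j : ℕ) : ℤ)) * d = 0 := by
        have hi := h i
        have hj := h j
        linear_combination hij' - hi + hj
      rcases mul_eq_zero.1 this with h | h
      · apply Fin.ext; omega
      · exact absurd h hd
    have hsurj := Finite.surjective_of_injective hinj
    rintro _ ⟨i, rfl⟩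
    obtain ⟨j, hj⟩ := hsurj i
    exact ⟨j, Prod.ext (hsame j) hj⟩

end Disjoint

/-! ### Partite amalgamation over a Hales–Jewett cube -/

section Amalgam

variable {k : ℕ} {P V ι : Type} (τ : P → V) (v : V)

/-- The copies of `P` along all combinatorial lines over the fibre of `τ` above `v`, glued along
the cube over that fibre. -/
abbrev Amalgam (ι : Type) : Type :=
  (ι → {x // τ x = v}) ⊕ (Line {x // τ x = v} ι × {x // τ x ≠ v})

open Classical in
/-- The copy of `P` in the amalgam that belongs to the line `l`. -/
noncomputable def amalgamCopy (l : Line {x // τ x = v} ι) (x : P) : Amalgam τ v ι :=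
  if h : τ x = v then Sum.inl (l ⟨x, h⟩) else Sum.inr (l, ⟨x, h⟩)

variable {τ v}

/-- The coordinates of a point of the amalgam. -/
def amalgamCoord (c : ι) : Amalgam τ v ι → P
  | Sum.inl z => z c
  | Sum.inr (l, x) => ((l.idxFun c).map Subtype.val).getD x

/-- The projection of the amalgam induced by `τ`. -/
def amalgamProj : Amalgam τ v ι → V
  | Sum.inl _ => v
  | Sum.inr (_, x) => τ x

open Classical in
/-- The extension by zero of the function `h` from the copy that belongs to `l`, for functions
that vanish on the fibre. -/
noncomputable def amalgamExtend (h : P → ℤ) (l : Line {x // τ x = v} ι) : Amalgam τ v ι → ℤ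
  | Sum.inl _ => 0
  | Sum.inr (l', x) => if l' = l then h x else 0

lemma amalgamCoord_copy (c : ι) (l : Line {x // τ x = v} ι) (x : P) :
    amalgamCoord c (amalgamCopy τ v l x) = ((l.idxFun c).map Subtype.val).getD x := by
  unfold amalgamCopy
  split_ifs with h
  · simp only [amalgamCoord, Line.coe_apply]
    cases l.idxFun c <;> rfl
  · rfl

lemma amalgamProj_copy (l : Line {x // τ x = v} ι) (x : P) :
    amalgamProj (amalgamCopy τ v l x) = τ x := by
  unfold amalgamCopy
  split_ifs with h
  · exact h.symm
  · rfl

open Classical in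
lemma amalgamExtend_copy {h : P → ℤ} (hh : ∀ x, τ x = v → h x = 0)
    (l l' : Line {x // τ x = v} ι) (x : P) :
    amalgamExtend h l (amalgamCopy τ v l' x) = if l' = l then h x else 0 := by
  unfold amalgamCopy
  split_ifs with h1 h2
  · simp [amalgamExtend, hh x h1]
  · rfl
  · simp [amalgamExtend, *]
  · simp [amalgamExtend, *]

lemma amalgamCoord_inr_eq_iff (l : Line {x // τ x = v} ι) (x : {x // τ x ≠ v}) (c : ι) :
    τ (amalgamCoord c (Sum.inr (l, x) : Amalgam τ v ι)) = v ↔ l.idxFun c ≠ none := by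
  simp only [amalgamCoord]
  cases h : l.idxFun c with
  | none => simpa using x.2
  | some z => simpa using z.2

/-- Outside the cube, the active coordinates of the line are those where the point lies off the
fibre. The other coordinates show the fixed values of the line, and any active one shows the point
of `P`. -/
lemma amalgamCoord_injective {y y' : Amalgam τ v ι}
    (h : ∀ c, amalgamCoord c y = amalgamCoord c y') : y = y' := by
  have key : ∀ (z : ι → {x // τ x = v}) (l : Line {x // τ x = v} ι) (x : {x // τ x ≠ v}),
      ¬ ∀ c, amalgamCoord c (Sum.inl z : Amalgam τ v ι) = amalgamCoord c (Sum.inr (l, x)) := by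
    intro z l x h
    obtain ⟨c, hc⟩ := l.proper
    have h1 := (amalgamCoord_inr_eq_iff l x c).1 (by rw [← h c]; exact (z c).2)
    exact h1 hc
  rcases y with z | ⟨l, x⟩ <;> rcases y' with z' | ⟨l', x'⟩
  · congr 1
    funext c
    exact Subtype.ext (h c)
  · exact absurd h (key _ _ _)
  · exact absurd (fun c => (h c).symm) (key _ _ _)
  · have hl : l = l' := by
      ext1
      funext c
      have h1 := amalgamCoord_inr_eq_iff l x c
      have h2 := amalgamCoord_inr_eq_iff l' x' c
      have h3 := h c
      rw [h3] at h1
      simp only [amalgamCoord] at h3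
      cases hc : l.idxFun c with
      | none =>
        cases hc' : l'.idxFun c with
        | none => rfl
        | some w => exact absurd hc (h1.1 (h2.2 (by simp [hc'])))
      | some w =>
        cases hc' : l'.idxFun c with
        | none => exact absurd hc' (h2.1 (h1.2 (by simp [hc])))
        | some w' =>
          rw [hc, hc'] at h3
          congr 1
          exact Subtype.ext h3
    subst hl
    obtain ⟨c, hc⟩ := l.proper
    have h3 := h c
    simp only [amalgamCoord, hc] at h3
    congr 2
    exact Subtype.ext h3

instance {α ι : Type} [Finite α] [Finite ι] : Finite (Line α ι) :=
  Finite.of_injective Line.idxFun fun _ _ h => Line.ext h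

variable (v) in
/-- The copies of the edges of `E` in the amalgam. -/
def amalgamEdges (τ : P → V) (E : Set (Fin k → P)) (ι : Type) : Set (Fin k → Amalgam τ v ι) :=
  {e' | ∃ l, ∃ e ∈ E, e' = fun i => amalgamCopy τ v l (e i)}

/-- On the copy along `l`, coordinate `c` is the identity if `c` is active in `l` and constant
otherwise. -/
lemma isAPFun_amalgamCoord {E : Set (Fin k → P)} {g : P → ℤ} (hg : IsAPFun E g) (c : ι) :
    IsAPFun (amalgamEdges v τ E ι) (fun y => g (amalgamCoord c y)) := by
  rintro _ ⟨l, e, he, rfl⟩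
  simp only [amalgamCoord_copy]
  cases l.idxFun c with
  | none => exact hg e he
  | some w => exact isAP_const (g w)

lemma isAPFun_amalgamExtend {E : Set (Fin k → P)} {h : P → ℤ} (hE : IsAPFun E h)
    (hh : ∀ x, τ x = v → h x = 0) (l : Line {x // τ x = v} ι) :
    IsAPFun (amalgamEdges v τ E ι) (amalgamExtend h l) := by
  classical
  rintro _ ⟨l', e, he, rfl⟩
  simp only [amalgamExtend_copy hh]
  split_ifs
  · exact hE e he
  · exact isAP_const 0

/-- In a faithful system whose edges are not constant under some function, the functions
respecting the edges separate points. -/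
lemma Faithful.eq_of_forall (hk : 3 ≤ k) {E : Set (Fin k → P)} (hE : Faithful E) {h : P → ℤ}
    (hAP : IsAPFun E h) (hne : ∀ e ∈ E, ∃ i j, h (e i) ≠ h (e j)) {x y : P}
    (hxy : ∀ g, IsAPFun E g → g x = g y) : x = y := by
  classical
  have h0 : (⟨0, by omega⟩ : Fin k) ≠ ⟨1, by omega⟩ := by simp
  rcases hE (fun i => if i = ⟨0, by omega⟩ then x else y) (fun g hg => by
    have : (fun i : Fin k => g (if i = ⟨0, by omega⟩ then x else y)) = fun _ => g y := by
      funext i; split_ifs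
      · exact hxy g hg
      · rfl
    rw [this]
    exact isAP_const _) with hc | ⟨e, he, hr⟩
  · have := hc ⟨0, by omega⟩ ⟨1, by omega⟩
    simpa [h0.symm] using this
  · obtain ⟨i, j, hij⟩ := hne e he
    have : ∀ i, h (e i) = h y := by
      intro i
      obtain ⟨m, hm⟩ := hr ⟨i, rfl⟩
      rw [← hm]
      dsimp only
      split_ifs
      · exact hxy h hAP
      · rfl
    exact absurd ((this i).trans (this j).symm) hij

/-- If all extensions of `h` vanish on the tuple, then `h` vanishes on each of its coordinates,
which therefore cover no edge and are constant. Otherwise some extension along `l` is a nonzero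
progression on the tuple; it has at most one zero, so all points but at most one lie in the copy
along `l`. The last point is forced into it as well, and faithfulness of `E` applies within that
copy. -/
lemma faithful_amalgamEdges (hk : 3 ≤ k) {E : Set (Fin k → P)} (hE : Faithful E) {h : P → ℤ}
    (hAP : IsAPFun E h) (hne : ∀ e ∈ E, ∃ i j, h (e i) ≠ h (e j))
    (hh : ∀ x, τ x = v → h x = 0) : Faithful (amalgamEdges v τ E ι) := by
  classical
  intro y hy
  have hcoord : ∀ c g, IsAPFun E g → IsAP (fun i => g (amalgamCoord c (y i))) :=
    fun c g hg => hy _ (isAPFun_amalgamCoord hg c)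
  have hext : ∀ l, IsAP (fun i => amalgamExtend h l (y i)) :=
    fun l => hy _ (isAPFun_amalgamExtend hAP hh l)
  by_cases hall : ∀ l i, amalgamExtend h l (y i) = 0
  · left
    have hzero : ∀ c i, h (amalgamCoord c (y i)) = 0 := by
      intro c i
      have h1 := fun l => hall l i
      rcases hyi : y i with z | ⟨l, x⟩
      · exact hh _ (z c).2
      · simp only [hyi] at h1
        simp only [amalgamCoord]
        cases l.idxFun c with
        | none => simpa [amalgamExtend] using h1 l
        | some w => exact hh _ w.2
    intro i j
    refine amalgamCoord_injective fun c => ?_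
    rcases hE (fun i => amalgamCoord c (y i)) (hcoord c) with hc | ⟨e, he, hr⟩
    · exact hc i j
    · obtain ⟨a, b, hab⟩ := hne e he
      have : ∀ a, h (e a) = 0 := by
        intro a
        obtain ⟨m, hm⟩ := hr ⟨a, rfl⟩
        rw [← hm]
        exact hzero c m
      exact absurd ((this a).trans (this b).symm) hab
  · push Not at hall
    obtain ⟨l, i₀, hi₀⟩ := hall
    have hform : ∀ i, amalgamExtend h l (y i) ≠ 0 →
        ∃ x : {x // τ x ≠ v}, y i = Sum.inr (l, x) := by
      intro i hi
      rcases hyi : y i with z | ⟨l', x⟩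
      · simp [hyi, amalgamExtend] at hi
      · by_cases hl : l' = l
        · exact ⟨x, by rw [hl]⟩
        · simp [hyi, amalgamExtend, hl] at hi
    have hcopy : ∀ j, ∃ x, y j = amalgamCopy τ v l x := by
      intro j
      by_cases hj : amalgamExtend h l (y j) = 0
      · have hoff : ∀ i, i ≠ j → ∃ x : {x // τ x ≠ v}, y i = Sum.inr (l, x) := by
          intro i hij
          apply hform
          intro hi
          exact hi₀ (congrFun ((hext l).eq_of_eq (isAP_const 0) hij hi hj) i₀)
        obtain ⟨c₀, hc₀⟩ := l.proper
        refine ⟨amalgamCoord c₀ (y j), amalgamCoord_injective fun c => ?_⟩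
        rw [amalgamCoord_copy]
        -- Two other positions lie in the copy along `l`, where coordinate `c` agrees with `c₀` or
        -- is constant. Two agreements of progressions determine the value at `j`.
        obtain ⟨a, b, ha, hb, hab⟩ := exists_two_ne hk j
        obtain ⟨xa, hxa⟩ := hoff a ha
        obtain ⟨xb, hxb⟩ := hoff b hb
        refine hE.eq_of_forall hk hAP hne fun g hg => ?_
        cases hc : l.idxFun c with
        | none =>
          refine congrFun ((hcoord c g hg).eq_of_eq (hcoord c₀ g hg) hab ?_ ?_) j
          · simp only [hxa, amalgamCoord, hc, hc₀]
          · simp only [hxb, amalgamCoord, hc, hc₀]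
        | some w =>
          refine congrFun ((hcoord c g hg).eq_of_eq (isAP_const (g w)) hab ?_ ?_) j
          · simp [hxa, amalgamCoord, hc]
          · simp [hxb, amalgamCoord, hc]
      · obtain ⟨x, hx⟩ := hform j hj
        exact ⟨x, by rw [hx, amalgamCopy, dif_neg x.2]⟩
    choose x hx using hcopy
    obtain ⟨c₀, hc₀⟩ := l.proper
    have hcx : ∀ i, amalgamCoord c₀ (y i) = x i := by
      intro i
      rw [hx, amalgamCoord_copy, hc₀]
      rfl
    rcases hE x (fun g hg => by simpa only [hcx] using hcoord c₀ g hg) with hc | ⟨e, he, hr⟩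
    · left
      intro i j
      rw [hx, hx, hc i j]
    · right
      refine ⟨_, ⟨l, e, he, rfl⟩, ?_⟩
      rintro _ ⟨i, rfl⟩
      obtain ⟨j, hj⟩ := hr ⟨i, rfl⟩
      exact ⟨j, by rw [hx, hj]⟩

end Amalgam

/-- The partite construction. -/
theorem exists_faithful_system {k : ℕ} (hk : 3 ≤ k) {V : Type} [Finite V]
    (EG : Set (Fin k → V)) (ℓ : V → ℤ) (hAP : IsAPFun EG ℓ)
    (hne : ∀ e ∈ EG, ∃ i j, ℓ (e i) ≠ ℓ (e j)) (r : ℕ) [NeZero r] (S : Finset V) :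
    ∃ (P : Type) (_ : Finite P) (E : Set (Fin k → P)) (τ : P → V),
      (∀ e ∈ E, (fun i => τ (e i)) ∈ EG) ∧ Faithful E ∧
      ∀ C : P → Fin r, ∃ D : V → Fin r, ∀ e ∈ EG, ∃ e' ∈ E,
        (fun i => τ (e' i)) = e ∧ ∀ i, e i ∈ S → C (e' i) = D (e i) := by
  classical
  induction S using Finset.induction_on with
  | empty =>
    refine ⟨EG × Fin k, inferInstance, disjointEdges EG, fun p => p.1.1 p.2, ?_,
      faithful_disjointEdges EG hk, fun C => ⟨0, fun e he => ⟨fun i => (⟨e, he⟩, i), ⟨_, rfl⟩, rfl,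
        by simp⟩⟩⟩
    rintro _ ⟨f, rfl⟩
    exact f.2
  | insert v S hv ih =>
    obtain ⟨P, _, E, τ, hτ, hE, hC⟩ := ih
    -- A monochromatic line in the cube over the fibre of `v` yields a copy of `P` whose fibre over
    -- `v` has one colour; the induction hypothesis in this copy controls the fibres over `S`.
    obtain ⟨ι, _, hι⟩ := Line.exists_mono_in_high_dimension {x // τ x = v} (Fin r)
    refine ⟨Amalgam τ v ι, inferInstance, amalgamEdges v τ E ι, amalgamProj, ?_, ?_, ?_⟩
    · rintro _ ⟨l, e, he, rfl⟩
      simpa only [amalgamProj_copy] using hτ e he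
    -- The level relative to `v` vanishes on the fibre and is nonconstant on every edge.
    · refine faithful_amalgamEdges hk hE (h := fun x => ℓ (τ x) - ℓ v) ?_ ?_ ?_
      · exact fun e he => (hAP _ (hτ e he)).sub_const _
      · intro e he
        obtain ⟨i, j, hij⟩ := hne _ (hτ e he)
        exact ⟨i, j, fun h => hij (sub_left_injective h)⟩
      · intro x hx
        simp [hx]
    · intro C
      obtain ⟨l, c, hl⟩ := hι fun z => C (Sum.inl z)
      obtain ⟨D, hD⟩ := hC fun x => C (amalgamCopy τ v l x)
      refine ⟨Function.update D v c, fun e he => ?_⟩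
      obtain ⟨e', he', hee, hS⟩ := hD e he
      refine ⟨_, ⟨l, e', he', rfl⟩, ?_, fun i hi => ?_⟩
      · simpa only [amalgamProj_copy] using hee
      · by_cases hiv : e i = v
        · have h1 : τ (e' i) = v := by rw [← hiv, ← hee]
          rw [hiv, Function.update_self, ← hl ⟨e' i, h1⟩, amalgamCopy, dif_pos h1]
        · rw [Function.update_of_ne hiv]
          exact hS i ((Finset.mem_insert.1 hi).resolve_left hiv)

/-! ### Generic realization by natural numbers -/

lemma IsAP.add {k : ℕ} {s t : Fin k → ℤ} (hs : IsAP s) (ht : IsAP t) :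
    IsAP (fun i => s i + t i) := by
  obtain ⟨a, d, hs⟩ := hs
  obtain ⟨b, e, ht⟩ := ht
  exact ⟨a + b, d + e, fun i => by simp only [hs, ht]; ring⟩

lemma IsAP.const_mul {k : ℕ} {s : Fin k → ℤ} (hs : IsAP s) (c : ℤ) :
    IsAP (fun i => c * s i) := by
  obtain ⟨a, d, hs⟩ := hs
  exact ⟨c * a, c * d, fun i => by simp only [hs]; ring⟩

lemma isAP_of_second_difference {k : ℕ} {s : Fin k → ℤ}
    (h : ∀ i (h2 : i + 2 < k), s ⟨i, by omega⟩ - 2 * s ⟨i + 1, by omega⟩ + s ⟨i + 2, h2⟩ = 0) :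
    IsAP s := by
  rcases Nat.lt_or_ge k 2 with hk | hk
  · rcases Nat.eq_zero_or_pos k with rfl | h0
    · exact ⟨0, 0, fun i => i.elim0⟩
    · refine ⟨s ⟨0, h0⟩, 0, fun i => ?_⟩
      have : i = ⟨0, h0⟩ := Fin.ext (by have := i.2; simp only; omega)
      rw [this]; simp
  · refine ⟨s ⟨0, by omega⟩, s ⟨1, by omega⟩ - s ⟨0, by omega⟩, ?_⟩
    have key : ∀ n (hn : n + 1 < k),
        s ⟨n, by omega⟩ = s ⟨0, by omega⟩ + (n : ℤ) * (s ⟨1, by omega⟩ - s ⟨0, by omega⟩) ∧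
        s ⟨n + 1, hn⟩ =
          s ⟨0, by omega⟩ + ((n + 1 : ℕ) : ℤ) * (s ⟨1, by omega⟩ - s ⟨0, by omega⟩) := by
      intro n
      induction n with
      | zero => intro hn; simp
      | succ n ih =>
        intro hn
        obtain ⟨h1, h2⟩ := ih (by omega)
        refine ⟨h2, ?_⟩
        have h3 := h n hn
        push_cast at h1 h2 ⊢
        linear_combination h3 - h1 + 2 * h2
    rintro ⟨i, hi⟩
    rcases i with _ | i
    · simp
    · exact (key i hi).2

lemma exists_int_linear_ne_zero {α : Type} (T : Finset α) (φ ψ : α → ℤ)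
    (h : ∀ t ∈ T, φ t ≠ 0 ∨ ψ t ≠ 0) : ∃ n : ℤ, ∀ t ∈ T, φ t + n * ψ t ≠ 0 := by
  classical
  obtain ⟨n, hn⟩ := Infinite.exists_notMem_finset (T.image fun t => -φ t / ψ t)
  refine ⟨n, fun t ht h0 => ?_⟩
  by_cases hψ : ψ t = 0
  · rcases h t ht with h1 | h1
    · exact h1 (by simpa [hψ] using h0)
    · exact h1 hψ
  · refine hn (Finset.mem_image.2 ⟨t, ht, ?_⟩)
    rw [show -φ t = n * ψ t by linarith]
    exact Int.mul_ediv_cancel _ hψ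

/-- A finite set of functionals, each nonzero somewhere on the edge-respecting functions, is
simultaneously nonzero at one such function. -/
lemma exists_isAPFun_generic {k : ℕ} {P : Type} (E : Set (Fin k → P)) (T : Finset (P × P × P))
    (hT : ∀ t ∈ T, ∃ g, IsAPFun E g ∧ g t.1 - 2 * g t.2.1 + g t.2.2 ≠ 0) :
    ∃ g, IsAPFun E g ∧ ∀ t ∈ T, g t.1 - 2 * g t.2.1 + g t.2.2 ≠ 0 := by
  classical
  induction T using Finset.induction_on with
  | empty => exact ⟨fun _ => 0, fun _ _ => isAP_const 0, by simp⟩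
  | insert t T ht ih =>
    obtain ⟨g, hg, hgT⟩ := ih fun t ht => hT t (Finset.mem_insert_of_mem ht)
    obtain ⟨g', hg', hgt⟩ := hT t (Finset.mem_insert_self _ _)
    obtain ⟨n, hn⟩ := exists_int_linear_ne_zero (insert t T)
      (fun u => g u.1 - 2 * g u.2.1 + g u.2.2) (fun u => g' u.1 - 2 * g' u.2.1 + g' u.2.2) (by
        intro u hu
        rcases Finset.mem_insert.1 hu with rfl | hu
        · exact Or.inr hgt
        · exact Or.inl (hgT u hu))
    refine ⟨fun p => g p + n * g' p, fun e he => (hg e he).add ((hg' e he).const_mul n), ?_⟩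
    intro u hu h0
    refine hn u hu ?_
    linear_combination h0

/-- A finite faithful system can be realized by natural numbers. -/
theorem Faithful.exists_nat_embedding {k : ℕ} (hk : 3 ≤ k) {P : Type} [Finite P]
    {E : Set (Fin k → P)} (hE : Faithful E) {h : P → ℤ} (hAP : IsAPFun E h)
    (hne : ∀ e ∈ E, ∃ i j, h (e i) ≠ h (e j)) :
    ∃ f : P → ℕ, Function.Injective f ∧ IsAPFun E (fun p => (f p : ℤ)) ∧
      ∀ x : Fin k → P, IsAP (fun i => (f (x i) : ℤ)) →
        (∀ i j, x i = x j) ∨ ∃ e ∈ E, Set.range e ⊆ Set.range x := by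
  classical
  cases nonempty_fintype P
  -- A second difference of `g` vanishes only if it vanishes for all edge-respecting functions, so
  -- `g` alone detects which tuples are always sent to progressions.
  obtain ⟨g, hg, hgT⟩ := exists_isAPFun_generic E
    (Finset.univ.filter fun t => ∃ g, IsAPFun E g ∧ g t.1 - 2 * g t.2.1 + g t.2.2 ≠ 0)
    (fun t ht => (Finset.mem_filter.1 ht).2)
  have hg0 : ∀ p q s, g p - 2 * g q + g s = 0 →
      ∀ g', IsAPFun E g' → g' p - 2 * g' q + g' s = 0 := by
    intro p q s h0 g' hg'
    by_contra hcon
    exact hgT (p, q, s) (Finset.mem_filter.2 ⟨Finset.mem_univ _, g', hg', hcon⟩) h0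
  set M : ℤ := ∑ p, |g p| with hM
  have hpos : ∀ p, 0 ≤ g p + M := by
    intro p
    have h1 : |g p| ≤ M := Finset.single_le_sum (fun q _ => abs_nonneg (g q)) (Finset.mem_univ p)
    have h2 := neg_abs_le (g p)
    linarith
  have hcast : ∀ p, (((g p + M).toNat : ℕ) : ℤ) = g p + M := fun p => Int.toNat_of_nonneg (hpos p)
  refine ⟨fun p => (g p + M).toNat, ?_, ?_, ?_⟩
  · intro p q hpq
    have h1 : g p = g q := by
      have := congrArg (fun n : ℕ => (n : ℤ)) hpq
      simp only [hcast] at this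
      linarith
    refine hE.eq_of_forall hk hAP hne fun g' hg' => ?_
    -- On the triple `(p, q, q)` the second difference is `g' p - g' q`.
    have := hg0 p q q (by linarith) g' hg'
    linarith
  · intro e he
    simp only [hcast]
    exact (hg e he).add (isAP_const M)
  · intro x hx
    simp only [hcast] at hx
    refine hE x fun g' hg' => isAP_of_second_difference fun i h2 => hg0 _ _ _ ?_ g' hg'
    obtain ⟨a, d, hx⟩ := hx
    have e0 := hx ⟨i, by omega⟩
    have e1 := hx ⟨i + 1, by omega⟩
    have e2 := hx ⟨i + 2, h2⟩
    push_cast at e0 e1 e2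
    linear_combination e0 - 2 * e1 + e2

/-! ### Ramsey property of the shift hypergraph -/

/-- Every finite colouring of the windows of length `m + 1` has two consecutive windows of the same
colour. -/
lemma exists_consecutive_windows (m : ℕ) : ∀ (κ : Type) [Finite κ], ∃ N : ℕ,
    ∀ c : (Fin (m + 1) → Fin N) → κ, ∃ w : Fin (m + 2) → Fin N,
      StrictMono w ∧ c (Fin.init w) = c (Fin.tail w) := by
  induction m with
  | zero =>
    intro κ _
    cases nonempty_fintype κ
    refine ⟨Fintype.card κ + 1, fun c => ?_⟩
    have key : ∃ a b : Fin (Fintype.card κ + 1), a < b ∧ c (fun _ => a) = c (fun _ => b) := by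
      obtain ⟨a, b, hab, h⟩ := Fintype.exists_ne_map_eq_of_card_lt
        (fun n : Fin (Fintype.card κ + 1) => c (fun _ => n)) (by simp)
      rcases lt_or_gt_of_ne hab with h1 | h1
      · exact ⟨a, b, h1, h⟩
      · exact ⟨b, a, h1, h.symm⟩
    obtain ⟨a, b, hab, h⟩ := key
    refine ⟨![a, b], ?_, ?_⟩
    · rw [Fin.strictMono_iff_lt_succ]
      intro i
      fin_cases i
      simpa using hab
    · convert h using 2
      · funext i
        fin_cases i
        rfl
      · funext i
        fin_cases i
        rfl
  | succ m ih =>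
    intro κ _
    obtain ⟨N, hN⟩ := ih (Set κ)
    refine ⟨N, fun c => ?_⟩
    -- A shorter window is coloured by the set of colours of its extensions to the right. Equal sets
    -- for `init w` and `tail w` supply a successor of `w` with the colour of `w`.
    obtain ⟨w, hw, hc⟩ := hN fun u => {j | ∃ w, StrictMono w ∧ Fin.init w = u ∧ c w = j}
    have h1 : c w ∈ {j | ∃ w', StrictMono w' ∧ Fin.init w' = Fin.tail w ∧ c w' = j} := by
      rw [← hc]
      exact ⟨w, hw, rfl, rfl⟩
    obtain ⟨w', hw', hi, hcw⟩ := h1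
    have hinit : Fin.init (Fin.cons (w 0) w' : Fin (m + 3) → Fin N) = w := by
      funext i
      refine Fin.cases ?_ (fun i => ?_) i
      · rfl
      · exact congrFun hi i
    refine ⟨Fin.cons (w 0) w', ?_, ?_⟩
    · rw [Fin.strictMono_iff_lt_succ]
      intro i
      refine Fin.cases ?_ (fun i => ?_) i
      · have : w' 0 = w 1 := congrFun hi 0
        simp only [Fin.castSucc_zero, Fin.cons_zero, Fin.cons_succ]
        rw [this]
        exact hw (by simp)
      · rw [← Fin.succ_castSucc, Fin.cons_succ, Fin.cons_succ]
        exact hw' (Fin.castSucc_lt_succ)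
    · rw [hinit, Fin.tail_cons, hcw]

/-- Every finite colouring of the windows of a given length has `k` consecutive windows of the same
colour. -/
lemma exists_monochromatic_windows (m k : ℕ) (hk : 1 ≤ k) (κ : Type) [Finite κ] : ∃ N : ℕ,
    ∀ c : (Fin (m + 2) → Fin N) → κ, ∃ (j : κ) (e : ℕ → Fin (m + 2) → Fin N),
      (∀ i < k, StrictMono (e i) ∧ c (e i) = j) ∧
      ∀ i, i + 1 < k → Fin.tail (e i) = Fin.init (e (i + 1)) := by
  obtain ⟨N, hN⟩ := exists_consecutive_windows m (Set (Fin k × κ))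
  refine ⟨N, fun c => ?_⟩
  let W : ℕ → κ → (Fin (m + 1) → Fin N) → Prop := fun t j u =>
    ∃ e : ℕ → Fin (m + 2) → Fin N, (∀ i < t, StrictMono (e i) ∧ c (e i) = j) ∧
      (∀ i, i + 1 < t → Fin.tail (e i) = Fin.init (e (i + 1))) ∧
      ∀ i, i + 1 = t → Fin.tail (e i) = u
  -- A shorter window records for which `t < k` and `j` a chain of `t` windows of colour `j` ends in
  -- it. Appending `w` moves a chain from `init w` to `tail w`, and equality of the records moves
  -- its length back to `init w`, so the length climbs to `k`.
  obtain ⟨w, hw, hc⟩ := hN fun u => {p | W p.1 p.2 u}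
  have hext : ∀ t, W t (c w) (Fin.init w) → W (t + 1) (c w) (Fin.tail w) := by
    rintro t ⟨e, h1, h2, h3⟩
    refine ⟨fun i => if i < t then e i else w, fun i hi => ?_, fun i hi => ?_, fun i hi => ?_⟩
    · dsimp only
      split_ifs with hit
      · exact h1 i hit
      · exact ⟨hw, rfl⟩
    · have hit : i < t := by omega
      dsimp only
      rw [if_pos hit]
      split_ifs with hit'
      · exact h2 i hit'
      · exact h3 i (by omega)
    · have hit : ¬ i < t := by omega
      dsimp only
      rw [if_neg hit]
  have hback : ∀ t < k, W t (c w) (Fin.tail w) → W t (c w) (Fin.init w) := by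
    intro t ht h
    have h1 : ((⟨t, ht⟩, c w) : Fin k × κ) ∈ {p : Fin k × κ | W p.1 p.2 (Fin.tail w)} := h
    rw [← hc] at h1
    exact h1
  have hW : ∀ t < k, W t (c w) (Fin.init w) := by
    intro t
    induction t with
    | zero => exact fun _ => ⟨fun _ => w, by simp, by simp, by simp⟩
    | succ t ih => exact fun ht => hback _ ht (hext t (ih (by omega)))
  obtain ⟨e, h1, h2, -⟩ := hext (k - 1) (hW (k - 1) (by omega))
  rw [Nat.sub_add_cancel hk] at h1 h2
  exact ⟨c w, e, h1, h2⟩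

/-- The tuples of `k` windows each of which arises from the preceding one by a shift. -/
def shiftEdges (k m N : ℕ) : Set (Fin k → (Fin m ↪ Fin N)) :=
  {e | ∀ (i : ℕ) (hi : i + 1 < k) (j : ℕ) (hj : j + 1 < m),
    e ⟨i + 1, hi⟩ ⟨j, by omega⟩ = e ⟨i, by omega⟩ ⟨j + 1, hj⟩}

lemma exists_monochromatic_shiftEdge (k m r : ℕ) (hk : 1 ≤ k) (hm : 2 ≤ m) (hr : 1 ≤ r) :
    ∃ N : ℕ, ∀ D : (Fin m ↪ Fin N) → Fin r,
      ∃ e ∈ shiftEdges k m N, ∀ i j, D (e i) = D (e j) := by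
  classical
  obtain ⟨m, rfl⟩ := Nat.exists_eq_add_of_le' hm
  obtain ⟨N, hN⟩ := exists_monochromatic_windows m k hk (Fin r)
  refine ⟨N, fun D => ?_⟩
  obtain ⟨j, e, h1, h2⟩ := hN fun w =>
    if h : Function.Injective w then D ⟨w, h⟩ else ⟨0, hr⟩
  refine ⟨fun i => ⟨e i, (h1 i i.2).1.injective⟩, ?_, ?_⟩
  · intro i hi a ha
    exact (congrFun (h2 i hi) ⟨a, by omega⟩).symm
  · have : ∀ i : Fin k, D ⟨e i, (h1 i i.2).1.injective⟩ = j := by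
      intro i
      have := (h1 i i.2).2
      rwa [dif_pos (h1 i i.2).1.injective] at this
    intro a b
    rw [this, this]

lemma shiftEdges_apply {k m N : ℕ} {e : Fin k → (Fin m ↪ Fin N)} (he : e ∈ shiftEdges k m N)
    (i d : ℕ) (hd : i + d < k) (j : ℕ) (hj : j + d < m) :
    e ⟨i + d, hd⟩ ⟨j, by omega⟩ = e ⟨i, by omega⟩ ⟨j + d, hj⟩ := by
  induction d generalizing j with
  | zero => rfl
  | succ d ih =>
    have h1 := he (i + d) (by omega) j (by omega)
    have h2 := ih (by omega) (j + 1) (by omega)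
    simp only [← Nat.add_assoc] at *
    rw [h1, h2]
    congr 1
    apply Fin.ext
    simp only
    omega

/-! ### Vertex covers of frequency close to `1 / k` -/

/-- The windows whose entry of largest rank under `σ` stands close to an end or at a position
congruent to `t`. -/
def shiftHitting (k m N : ℕ) (ω : Equiv.Perm (Fin N) × Fin k) : Set (Fin m ↪ Fin N) :=
  {v | ∃ j, (∀ j', ω.1 (v j') ≤ ω.1 (v j)) ∧
    ((j : ℕ) < k ∨ m ≤ (j : ℕ) + k ∨ (j : ℕ) % k = ω.2)}

/-- The entry of largest rank in the whole edge is also the largest in each window containing it.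
Away from the ends it occurs in all `k` windows, at `k` consecutive positions, one of which is
congruent to `t`. -/
lemma shiftHitting_hits {k m N : ℕ} (hk : 1 ≤ k) (hm : 1 ≤ m) {e : Fin k → (Fin m ↪ Fin N)}
    (he : e ∈ shiftEdges k m N) (ω : Equiv.Perm (Fin N) × Fin k) :
    ∃ i, e i ∈ shiftHitting k m N ω := by
  have : Nonempty (Fin k × Fin m) := ⟨(⟨0, hk⟩, ⟨0, hm⟩)⟩
  obtain ⟨⟨i, j⟩, hmax⟩ := Finite.exists_max fun p : Fin k × Fin m => ω.1 (e p.1 p.2)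
  by_cases hj : (j : ℕ) < k ∨ m ≤ (j : ℕ) + k
  · exact ⟨i, j, fun j' => hmax (i, j'), by tauto⟩
  · push Not at hj
    obtain ⟨hj1, hj2⟩ := hj
    obtain ⟨i, hi⟩ := i
    obtain ⟨j, hjm⟩ := j
    obtain ⟨σ, ⟨t, ht⟩⟩ := ω
    simp only at hj1 hj2
    obtain ⟨i', hi', p, hp, hpt⟩ : ∃ i' < k, ∃ p, p + i' = j + i ∧ p % k = t := by
      -- The summand `k` keeps the subtraction of `t < k` from truncating.
      refine ⟨(j + i + k - t) % k, Nat.mod_lt _ hk, j + i - (j + i + k - t) % k, ?_, ?_⟩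
      · have := Nat.mod_lt (j + i + k - t) hk
        omega
      · have h1 := Nat.mod_lt (j + i + k - t) hk
        have h2 := Nat.mod_add_div (j + i + k - t) k
        set q := (j + i + k - t) / k
        set s := (j + i + k - t) % k
        have h3 : j + i - s + k = t + k * q := by omega
        rw [← Nat.add_mod_right, h3, Nat.add_mul_mod_self_left, Nat.mod_eq_of_lt ht]
    have hval : e ⟨i', hi'⟩ ⟨p, by omega⟩ = e ⟨i, hi⟩ ⟨j, hjm⟩ := by
      rcases le_total i i' with h | h
      · obtain ⟨d, rfl⟩ := Nat.exists_eq_add_of_le h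
        rw [shiftEdges_apply he i d hi' p (by omega)]
        congr 1
        apply Fin.ext
        simp only
        omega
      · obtain ⟨d, rfl⟩ := Nat.exists_eq_add_of_le h
        rw [shiftEdges_apply he i' d hi j (by omega)]
        congr 1
        apply Fin.ext
        simp only
        omega
    refine ⟨⟨i', hi'⟩, ⟨p, by omega⟩, fun j' => ?_, Or.inr (Or.inr hpt)⟩
    rw [hval]
    exact hmax (_, j')

-- Composition with the transposition of `v a` and `v b` exchanges the two sets of permutations.
open Classical in
lemma card_perm_argmax {m N : ℕ} (v : Fin m ↪ Fin N) (a b : Fin m) :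
    (Finset.univ.filter fun σ : Equiv.Perm (Fin N) => ∀ j, σ (v j) ≤ σ (v a)).card =
      (Finset.univ.filter fun σ : Equiv.Perm (Fin N) => ∀ j, σ (v j) ≤ σ (v b)).card := by
  have key : ∀ (c d : Fin m) (σ : Equiv.Perm (Fin N)), (∀ j, σ (v j) ≤ σ (v c)) →
      ∀ j, (σ * Equiv.swap (v c) (v d)) (v j) ≤ (σ * Equiv.swap (v c) (v d)) (v d) := by
    intro c d σ h j
    rw [Equiv.Perm.mul_apply, Equiv.Perm.mul_apply, Equiv.swap_apply_right]
    have : Equiv.swap (v c) (v d) (v j) = v (Equiv.swap c d j) := by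
      rw [Equiv.swap_apply_def, Equiv.swap_apply_def]
      simp only [v.injective.eq_iff]
      split_ifs <;> rfl
    rw [this]
    exact h _
  refine Finset.card_bij (fun σ _ => σ * Equiv.swap (v a) (v b)) ?_ ?_ ?_
  · intro σ hσ
    simp only [Finset.mem_filter, Finset.mem_univ, true_and] at hσ ⊢
    exact key a b σ hσ
  · intro σ _ σ' _ h
    exact mul_right_cancel h
  · intro σ hσ
    simp only [Finset.mem_filter, Finset.mem_univ, true_and] at hσ
    refine ⟨σ * Equiv.swap (v b) (v a), ?_, ?_⟩
    · simp only [Finset.mem_filter, Finset.mem_univ, true_and]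
      exact key b a σ hσ
    · rw [Equiv.swap_comm (v b), mul_assoc, Equiv.swap_mul_self, mul_one]

-- The position of the largest entry is equidistributed. A position near an end (at most `2 * k` of
-- them) admits up to `k` residues, any other at most one.
open Classical in
lemma card_shiftHitting_le {k m N : ℕ} (v : Fin m ↪ Fin N) :
    m * (Finset.univ.filter fun ω => v ∈ shiftHitting k m N ω).card ≤
      Fintype.card (Equiv.Perm (Fin N)) * (m + 2 * k * k) := by
  rcases Nat.eq_zero_or_pos m with rfl | hm
  · simp
  let A : Fin m → Finset (Equiv.Perm (Fin N)) := fun a =>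
    Finset.univ.filter fun σ => ∀ j, σ (v j) ≤ σ (v a)
  let T : Fin m → Finset (Fin k) := fun j =>
    Finset.univ.filter fun t => (j : ℕ) < k ∨ m ≤ (j : ℕ) + k ∨ (j : ℕ) % k = t
  set c := (A ⟨0, hm⟩).card with hc
  have hA : ∀ a, (A a).card = c := fun a => card_perm_argmax v _ _
  have hmc : m * c ≤ Fintype.card (Equiv.Perm (Fin N)) := by
    have hdisj : ∀ a ∈ (Finset.univ : Finset (Fin m)), ∀ b ∈ (Finset.univ : Finset (Fin m)),
        a ≠ b → Disjoint (A a) (A b) := by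
      intro a _ b _ hab
      rw [Finset.disjoint_left]
      intro σ ha hb
      have h1 := (Finset.mem_filter.1 ha).2 b
      have h2 := (Finset.mem_filter.1 hb).2 a
      exact hab (v.injective (σ.injective (le_antisymm h2 h1)))
    have h1 := Finset.card_biUnion hdisj
    rw [Finset.sum_congr rfl (fun a _ => hA a), Finset.sum_const, Finset.card_univ,
      Fintype.card_fin, smul_eq_mul] at h1
    rw [← h1]
    exact Finset.card_le_univ _
  have hT : ∑ j, (T j).card ≤ m + 2 * k * k := by
    have h1 : ∀ j : Fin m, (T j).card ≤
        1 + ((if (j : ℕ) < k then k else 0) + (if m ≤ (j : ℕ) + k then k else 0)) := by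
      intro j
      by_cases h : (j : ℕ) < k ∨ m ≤ (j : ℕ) + k
      · have : (T j).card ≤ k := (Finset.card_le_univ _).trans (by simp)
        rcases h with h | h
        · rw [if_pos h]; omega
        · rw [if_pos h]; omega
      · have h2 : (T j).card ≤ 1 := by
          rw [Finset.card_le_one]
          intro s hs t ht
          have hs := (Finset.mem_filter.1 hs).2
          have ht := (Finset.mem_filter.1 ht).2
          apply Fin.ext
          omega
        omega
    have hlow : (Finset.univ.filter fun j : Fin m => (j : ℕ) < k).card ≤ k := by
      refine (Finset.card_le_card_of_injOn (t := Finset.range k) (fun j : Fin m => (j : ℕ))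
        (fun j hj => ?_) (fun a _ b _ h => Fin.ext h)).trans (Finset.card_range k).le
      simpa using hj
    have hhigh : (Finset.univ.filter fun j : Fin m => m ≤ (j : ℕ) + k).card ≤ k := by
      refine (Finset.card_le_card_of_injOn (t := Finset.range k)
        (fun j : Fin m => m - 1 - (j : ℕ)) (fun j hj => ?_)
        (fun a _ b _ h => Fin.ext ?_)).trans (Finset.card_range k).le
      · have h1 : m ≤ (j : ℕ) + k := by simpa using hj
        have h2 := j.2
        simp only [Finset.coe_range, Set.mem_Iio]
        omega
      · have h1 := a.2
        have h2 := b.2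
        simp only at h
        omega
    calc ∑ j, (T j).card ≤ ∑ j : Fin m,
          (1 + ((if (j : ℕ) < k then k else 0) + (if m ≤ (j : ℕ) + k then k else 0))) :=
          Finset.sum_le_sum fun j _ => h1 j
      _ = m + ((Finset.univ.filter fun j : Fin m => (j : ℕ) < k).card * k +
            (Finset.univ.filter fun j : Fin m => m ≤ (j : ℕ) + k).card * k) := by
          rw [Finset.sum_add_distrib, Finset.sum_add_distrib, ← Finset.sum_filter,
            ← Finset.sum_filter]
          simp
      _ ≤ m + (k * k + k * k) := by gcongr
      _ = m + 2 * k * k := by ring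
  have hsub : (Finset.univ.filter fun ω => v ∈ shiftHitting k m N ω) ⊆
      Finset.univ.biUnion fun j => A j ×ˢ T j := by
    intro ω hω
    obtain ⟨j, h1, h2⟩ := (Finset.mem_filter.1 hω).2
    refine Finset.mem_biUnion.2 ⟨j, Finset.mem_univ _, Finset.mem_product.2 ⟨?_, ?_⟩⟩
    · exact Finset.mem_filter.2 ⟨Finset.mem_univ _, h1⟩
    · exact Finset.mem_filter.2 ⟨Finset.mem_univ _, h2⟩
  have hcount : (Finset.univ.filter fun ω => v ∈ shiftHitting k m N ω).card ≤
      c * (m + 2 * k * k) :=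
    calc _ ≤ _ := Finset.card_le_card hsub
      _ ≤ ∑ j, (A j ×ˢ T j).card := Finset.card_biUnion_le
      _ = c * ∑ j, (T j).card := by
          rw [Finset.mul_sum]
          exact Finset.sum_congr rfl fun j _ => by rw [Finset.card_product, hA]
      _ ≤ c * (m + 2 * k * k) := Nat.mul_le_mul_left _ hT
  calc _ ≤ m * (c * (m + 2 * k * k)) := Nat.mul_le_mul_left _ hcount
    _ = m * c * (m + 2 * k * k) := by ring
    _ ≤ _ := Nat.mul_le_mul_right _ hmc

open Classical in
/-- There are `k`-uniform hypergraphs that are Ramsey for `r` colours but possess a family of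
vertex covers that covers every vertex with frequency only slightly above `1 / k`. -/
theorem exists_ramsey_hypergraph (k r : ℕ) (hk : 1 ≤ k) (hr : 1 ≤ r) (ρ : ℝ)
    (hρ : 1 / (k : ℝ) < ρ) :
    ∃ (V : Type) (_ : Fintype V) (E : Set (Fin k → V)) (Ω : Type) (_ : Fintype Ω) (_ : Nonempty Ω)
      (H : Ω → Set V),
      (∀ D : V → Fin r, ∃ e ∈ E, ∀ i j, D (e i) = D (e j)) ∧
      (∀ e ∈ E, ∀ ω, ∃ i, e i ∈ H ω) ∧
      ∀ v, ((Finset.univ.filter fun ω => v ∈ H ω).card : ℝ) ≤ ρ * Fintype.card Ω := by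
  have hk0 : (0 : ℝ) < k := by exact_mod_cast hk
  -- The frequency is at most `1 / k + 2 * k / m`; the summand 2 ensures `2 ≤ m`.
  obtain ⟨m, hm⟩ := exists_nat_gt (2 * k / (ρ - 1 / (k : ℝ)) + 2)
  have hρ' : 0 < ρ - 1 / (k : ℝ) := by linarith
  have hpos : 0 < 2 * k / (ρ - 1 / (k : ℝ)) := by positivity
  have hm2 : (2 : ℝ) ≤ m := by linarith
  have hm2' : 2 ≤ m := by exact_mod_cast hm2
  obtain ⟨N, hN⟩ := exists_monochromatic_shiftEdge k m r hk hm2' hr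
  refine ⟨Fin m ↪ Fin N, inferInstance, shiftEdges k m N, Equiv.Perm (Fin N) × Fin k,
    inferInstance, ⟨(1, ⟨0, hk⟩)⟩, shiftHitting k m N, hN,
    fun e he ω => shiftHitting_hits hk (by omega) he ω, fun v => ?_⟩
  have hcard : (m : ℝ) * ((Finset.univ.filter fun ω => v ∈ shiftHitting k m N ω).card : ℝ) ≤
      (Fintype.card (Equiv.Perm (Fin N)) : ℝ) * (m + 2 * k * k) := by
    exact_mod_cast card_shiftHitting_le (k := k) v
  rw [Fintype.card_prod, Fintype.card_fin]
  push_cast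
  set F : ℝ := (Fintype.card (Equiv.Perm (Fin N)) : ℝ)
  have hF : 0 ≤ F := Nat.cast_nonneg _
  have hkey : (m : ℝ) + 2 * k * k ≤ m * (ρ * k) := by
    have h1 : 2 * (k : ℝ) ≤ m * (ρ - 1 / (k : ℝ)) := by
      have : 2 * (k : ℝ) / (ρ - 1 / (k : ℝ)) ≤ m := by linarith
      rwa [div_le_iff₀ hρ'] at this
    have h2 := mul_le_mul_of_nonneg_right h1 hk0.le
    have h3 : (m : ℝ) * (ρ - 1 / (k : ℝ)) * k = m * (ρ * k) - m := by
      field_simp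
    linarith
  have hm0 : (0 : ℝ) < m := by linarith
  refine le_of_mul_le_mul_left (hcard.trans ?_) hm0
  calc F * (m + 2 * k * k) ≤ F * (m * (ρ * k)) := mul_le_mul_of_nonneg_left hkey hF
    _ = m * (ρ * (F * k)) := by ring

/-! ### Levels and finite Ramsey sets -/

/-- Multiplying a Ramsey hypergraph with a Hales–Jewett cube gives a Ramsey system whose vertices
have levels that form nonconstant arithmetic progressions along the edges. -/
lemma exists_levelled_system {k r : ℕ} (hk : 2 ≤ k) {V : Type} [Finite V] (E : Set (Fin k → V))
    (hE : ∀ D : V → Fin r, ∃ e ∈ E, ∀ i j, D (e i) = D (e j)) :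
    ∃ (W : Type) (_ : Finite W) (E' : Set (Fin k → W)) (π : W → V) (ℓ : W → ℤ),
      (∀ e ∈ E', (fun i => π (e i)) ∈ E) ∧ IsAPFun E' ℓ ∧
      (∀ e ∈ E', ∃ i j, ℓ (e i) ≠ ℓ (e j)) ∧
      ∀ D : W → Fin r, ∃ e ∈ E', ∀ i j, D (e i) = D (e j) := by
  classical
  obtain ⟨ι, _, hι⟩ := Line.exists_mono_in_high_dimension (Fin k) (V → Fin r)
  have hsum : ∀ l : Line (Fin k) ι, ∃ a d : ℤ, 0 < d ∧
      ∀ i, ∑ c, ((l i c : Fin k) : ℤ) = a + (i : ℤ) * d := by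
    intro l
    -- The difference is the number of active coordinates.
    refine ⟨∑ c, (l.idxFun c).elim (0 : ℤ) (fun w => ((w : Fin k) : ℤ)),
      ∑ c, (l.idxFun c).elim (1 : ℤ) (fun _ => 0), ?_, fun i => ?_⟩
    · obtain ⟨c₀, hc₀⟩ := l.proper
      refine Finset.sum_pos' (fun c _ => ?_) ⟨c₀, Finset.mem_univ _, by simp [hc₀]⟩
      cases l.idxFun c <;> simp
    · rw [Finset.mul_sum, ← Finset.sum_add_distrib]
      refine Finset.sum_congr rfl fun c _ => ?_
      rw [Line.coe_apply]
      cases l.idxFun c <;> simp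
  refine ⟨V × (ι → Fin k), inferInstance,
    {e | ∃ f ∈ E, ∃ l : Line (Fin k) ι, e = fun i => (f i, l i)}, Prod.fst,
    fun p => ∑ c, ((p.2 c : Fin k) : ℤ), ?_, ?_, ?_, fun D => ?_⟩
  · rintro _ ⟨f, hf, l, rfl⟩
    exact hf
  · rintro _ ⟨f, hf, l, rfl⟩
    obtain ⟨a, d, -, h⟩ := hsum l
    exact ⟨a, d, h⟩
  · rintro _ ⟨f, hf, l, rfl⟩
    obtain ⟨a, d, hd, h⟩ := hsum l
    refine ⟨⟨0, by omega⟩, ⟨1, by omega⟩, ?_⟩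
    simp only [h]
    push_cast
    intro h0
    linarith
  · obtain ⟨l, c, hl⟩ := hι fun z v => D (v, z)
    obtain ⟨e, he, hmono⟩ := hE c
    refine ⟨_, ⟨e, he, l, rfl⟩, fun i j => ?_⟩
    have h1 := fun i => congrFun (hl i) (e i)
    simp only at h1
    rw [h1, h1, hmono i j]

open Classical in
/-- If a family of sets covers every point with frequency at most `ρ`, then one of these sets
covers at most the fraction `ρ` of a given finite set. -/
lemma exists_small_inter {α Ω : Type} [Fintype Ω] [Nonempty Ω] (H : Ω → Set α) (ρ : ℝ)
    (hH : ∀ v, ((Finset.univ.filter fun ω => v ∈ H ω).card : ℝ) ≤ ρ * Fintype.card Ω)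
    (Y : Finset α) : ∃ ω, ((Y.filter fun y => y ∈ H ω).card : ℝ) ≤ ρ * Y.card := by
  by_contra! hcon
  have h1 : ∑ ω : Ω, ρ * (Y.card : ℝ) < ∑ ω : Ω, ((Y.filter fun y => y ∈ H ω).card : ℝ) :=
    Finset.sum_lt_sum_of_nonempty Finset.univ_nonempty fun ω _ => hcon ω
  have h2 : ∑ ω : Ω, (Y.filter fun y => y ∈ H ω).card =
      ∑ y ∈ Y, (Finset.univ.filter fun ω => y ∈ H ω).card := by
    simp only [Finset.card_filter]
    exact Finset.sum_comm
  have h3 : ∑ ω : Ω, ((Y.filter fun y => y ∈ H ω).card : ℝ) =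
      ∑ y ∈ Y, ((Finset.univ.filter fun ω => y ∈ H ω).card : ℝ) := by exact_mod_cast h2
  have h4 : ∑ y ∈ Y, ((Finset.univ.filter fun ω => y ∈ H ω).card : ℝ) ≤
      ∑ y ∈ Y, ρ * Fintype.card Ω := Finset.sum_le_sum fun y _ => hH y
  rw [h3] at h1
  simp only [Finset.sum_const, nsmul_eq_mul, Finset.card_univ] at h1 h4
  linarith

/-- The set `X` contains, for every colouring with `r` colours, a monochromatic arithmetic
progression of length `k`. -/
def IsRamseyForAP (k r : ℕ) (X : Set ℕ) : Prop :=
  ∀ c : ℕ → Fin r, ∃ a d : ℕ, 0 < d ∧ (∀ i < k, a + i * d ∈ X) ∧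
    ∀ i < k, c (a + i * d) = c a

/-- Every finite subset of `X` has a subset of relative density `μ` without arithmetic progressions
of length `k`. -/
def HasDenseAPFree (k : ℕ) (μ : ℝ) (X : Set ℕ) : Prop :=
  ∀ Y : Finset ℕ, (Y : Set ℕ) ⊆ X →
    ∃ Z : Finset ℕ, Z ⊆ Y ∧ μ * (Y.card : ℝ) ≤ (Z.card : ℝ) ∧ ¬ ContainsAP k (Z : Set ℕ)

theorem exists_finite_ramsey_set {k r : ℕ} (hk : 3 ≤ k) (hr : 1 ≤ r) {μ : ℝ}
    (hμ : μ < ((k : ℝ) - 1) / (k : ℝ)) :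
    ∃ X : Set ℕ, X.Finite ∧ IsRamseyForAP k r X ∧ HasDenseAPFree k μ X := by
  classical
  have hk0 : (0 : ℝ) < k := by
    have : 0 < k := by omega
    exact_mod_cast this
  have hρ : 1 / (k : ℝ) < 1 - μ := by
    have : ((k : ℝ) - 1) / (k : ℝ) = 1 - 1 / k := by field_simp
    linarith
  obtain ⟨V, _, E, Ω, _, _, H, hRam, hhit, hdens⟩ :=
    exists_ramsey_hypergraph k r (by omega) hr (1 - μ) hρ
  obtain ⟨W, _, E', π, ℓ, hπ, hℓ, hℓne, hRam'⟩ := exists_levelled_system (by omega) E hRam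
  have : NeZero r := ⟨by omega⟩
  cases nonempty_fintype W
  obtain ⟨P, _, E'', τ, hτ, hfaith, hpart⟩ :=
    exists_faithful_system hk E' ℓ hℓ hℓne r Finset.univ
  have hne'' : ∀ e ∈ E'', ∃ i j, ℓ (τ (e i)) ≠ ℓ (τ (e j)) := fun e he => hℓne _ (hτ e he)
  obtain ⟨f, hfinj, hfE, hfAP⟩ := hfaith.exists_nat_embedding hk (h := fun p => ℓ (τ p))
    (fun e he => hℓ _ (hτ e he)) hne''
  refine ⟨Set.range f, Set.finite_range f, fun c => ?_, fun Y hY => ?_⟩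
  · obtain ⟨D, hD⟩ := hpart fun p => c (f p)
    obtain ⟨e, he, hmono⟩ := hRam' D
    obtain ⟨e', he', hee, hcol⟩ := hD e he
    have hcol' : ∀ i j, c (f (e' i)) = c (f (e' j)) := fun i j => by
      rw [hcol i (Finset.mem_univ _), hcol j (Finset.mem_univ _), hmono i j]
    obtain ⟨a, d, had⟩ := hfE e' he'
    beta_reduce at had
    have hd : d ≠ 0 := by
      rintro rfl
      obtain ⟨i, j, hij⟩ := hne'' e' he'
      refine hij ?_
      have h1 := had i
      have h2 := had j
      rw [show e' i = e' j from hfinj (by omega)]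
    have e0 := had ⟨0, by omega⟩
    have e1 := had ⟨k - 1, by omega⟩
    push_cast at e0
    -- The edge may run downwards; it is then read from its last point.
    rcases lt_or_gt_of_ne hd with hneg | hpos
    · refine ⟨f (e' ⟨k - 1, by omega⟩), (-d).toNat, by omega, ?_⟩
      have hterm : ∀ i (hi : i < k), f (e' ⟨k - 1, by omega⟩) + i * (-d).toNat =
          f (e' ⟨k - 1 - i, by omega⟩) := by
        intro i hi
        have h1 := had ⟨k - 1 - i, by omega⟩
        have h2 : (((-d).toNat : ℕ) : ℤ) = -d := Int.toNat_of_nonneg (by omega)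
        have h3 : ((k - 1 - i : ℕ) : ℤ) = ((k - 1 : ℕ) : ℤ) - i := by omega
        zify
        rw [h2, h1, e1]
        simp only [h3]
        ring
      exact ⟨fun i hi => ⟨_, (hterm i hi).symm⟩, fun i hi => by rw [hterm i hi]; exact hcol' _ _⟩
    · refine ⟨f (e' ⟨0, by omega⟩), d.toNat, by omega, ?_⟩
      have hterm : ∀ i (hi : i < k), f (e' ⟨0, by omega⟩) + i * d.toNat = f (e' ⟨i, hi⟩) := by
        intro i hi
        have h1 := had ⟨i, hi⟩
        have h2 : ((d.toNat : ℕ) : ℤ) = d := Int.toNat_of_nonneg (by omega)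
        zify
        rw [h2, h1, e0]
        simp
      exact ⟨fun i hi => ⟨_, (hterm i hi).symm⟩, fun i hi => by rw [hterm i hi]; exact hcol' _ _⟩
  · obtain ⟨ω, hω⟩ := exists_small_inter (fun ω => {p | π (τ p) ∈ H ω}) (1 - μ)
      (fun p => hdens (π (τ p))) (Y.preimage f hfinj.injOn)
    have hcardY : (Y.preimage f hfinj.injOn).card = Y.card := by
      rw [Finset.card_preimage, Finset.filter_true_of_mem fun y hy => hY hy]
    have hsplit := Finset.card_filter_add_card_filter_not
      (s := Y.preimage f hfinj.injOn) (fun p => p ∈ {p | π (τ p) ∈ H ω})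
    refine ⟨((Y.preimage f hfinj.injOn).filter fun p => ¬ p ∈ {p | π (τ p) ∈ H ω}).image f,
      ?_, ?_, ?_⟩
    · intro z hz
      obtain ⟨p, hp, rfl⟩ := Finset.mem_image.1 hz
      exact Finset.mem_preimage.1 (Finset.mem_filter.1 hp).1
    · rw [Finset.card_image_of_injective _ hfinj]
      rw [hcardY] at hω hsplit
      have hsplit' : (((Y.preimage f hfinj.injOn).filter
          fun p => p ∈ {p | π (τ p) ∈ H ω}).card : ℝ) + (((Y.preimage f hfinj.injOn).filter
          fun p => ¬ p ∈ {p | π (τ p) ∈ H ω}).card : ℝ) = Y.card := by exact_mod_cast hsplit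
      linarith
    · rintro ⟨a, d, hd, hAP⟩
      have hx : ∀ i : Fin k, ∃ p, π (τ p) ∉ H ω ∧ f p = a + i * d := by
        intro i
        obtain ⟨p, hp, hpe⟩ := Finset.mem_image.1 (Finset.mem_coe.1 (hAP i i.2))
        exact ⟨p, (Finset.mem_filter.1 hp).2, hpe⟩
      choose x hxH hxf using hx
      rcases hfAP x ⟨a, d, fun i => by simp only [hxf]; push_cast; ring⟩ with hc | ⟨e, he, hr⟩
      · have h1 := hxf ⟨0, by omega⟩
        have h2 := hxf ⟨1, by omega⟩
        rw [hc ⟨0, by omega⟩ ⟨1, by omega⟩, h2] at h1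
        simp at h1
        omega
      -- The edge inside the progression projects to an edge of `E`, which the cover `H ω` meets,
      -- although all points above `H ω` were removed.
      · obtain ⟨i, hi⟩ := hhit _ (hπ _ (hτ e he)) ω
        obtain ⟨j, hj⟩ := hr ⟨i, rfl⟩
        exact hxH j (by rw [hj]; exact hi)

/-! ### Union of widely spaced translates -/

lemma IsRamseyForAP.translate {k r : ℕ} {X : Set ℕ} (hX : IsRamseyForAP k r X) (t : ℕ) :
    IsRamseyForAP k r ((fun x => t + x) '' X) := by
  intro c
  obtain ⟨a, d, hd, hmem, hc⟩ := hX fun x => c (t + x)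
  refine ⟨t + a, d, hd, fun i hi => ⟨_, hmem i hi, ?_⟩, fun i hi => ?_⟩
  · simp only; omega
  · rw [Nat.add_assoc]; exact hc i hi

lemma HasDenseAPFree.translate {k : ℕ} {μ : ℝ} {X : Set ℕ} (hX : HasDenseAPFree k μ X) (t : ℕ)
    (hk : 1 ≤ k) : HasDenseAPFree k μ ((fun x => t + x) '' X) := by
  classical
  intro Y hY
  have hinj : Function.Injective fun x : ℕ => t + x := add_right_injective t
  obtain ⟨Z, hZY, hZc, hZ⟩ := hX (Y.preimage _ hinj.injOn) (by
    intro x hx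
    obtain ⟨x', hx', he⟩ := hY (Finset.mem_preimage.1 hx)
    rwa [← hinj he])
  have hcard : (Y.preimage _ hinj.injOn).card = Y.card := by
    rw [Finset.card_preimage, Finset.filter_true_of_mem]
    intro y hy
    obtain ⟨x, _, hx⟩ := hY hy
    exact ⟨x, hx⟩
  refine ⟨Z.image fun x => t + x, ?_, ?_, ?_⟩
  · intro z hz
    obtain ⟨x, hx, rfl⟩ := Finset.mem_image.1 hz
    exact Finset.mem_preimage.1 (hZY hx)
  · rwa [Finset.card_image_of_injective _ hinj, ← hcard]
  · rintro ⟨a, d, hd, hAP⟩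
    have hta : t ≤ a := by
      obtain ⟨x, _, hx⟩ := Finset.mem_image.1 (Finset.mem_coe.1 (hAP 0 hk))
      omega
    refine hZ ⟨a - t, d, hd, fun i hi => ?_⟩
    obtain ⟨x, hxZ, hx⟩ := Finset.mem_image.1 (Finset.mem_coe.1 (hAP i hi))
    rw [show a - t + i * d = x by omega]
    exact hxZ

/-- An arithmetic progression in a union of rapidly spread short blocks lies in one block. -/
lemma exists_block_of_AP {k : ℕ} (hk : 3 ≤ k) {U : ℕ → Set ℕ} {t : ℕ → ℕ}
    (hpos : ∀ r, 0 < t r) (hlow : ∀ r, ∀ x ∈ U r, t r ≤ x) (hhigh : ∀ r, ∀ x ∈ U r, 8 * x < 9 * t r)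
    (hgap : ∀ r s, r < s → 8 * t r ≤ t s) {a d : ℕ} (hAP : ∀ i < k, a + i * d ∈ ⋃ r, U r) :
    ∃ r, ∀ i < k, a + i * d ∈ U r := by
  obtain ⟨n, rfl⟩ := Nat.exists_eq_add_of_le' hk
  obtain ⟨s, hs⟩ := Set.mem_iUnion.1 (hAP (n + 2) (by omega))
  have hT := hpos s
  have hs1 := hlow s _ hs
  have hs2 := hhigh s _ hs
  -- Earlier blocks end below `9 / 64` of `t s`, and later ones start beyond block `s`, which holds
  -- the last term. The penultimate term is at least half the last, so it is in block `s` too; this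
  -- makes `d` less than `t s / 8`, and descent never leaves the block.
  have hlarge : ∀ i < n + 3, t s ≤ 4 * (a + i * d) → a + i * d ∈ U s := by
    intro i hi h
    obtain ⟨r, hr⟩ := Set.mem_iUnion.1 (hAP i hi)
    have hr1 := hlow r _ hr
    have hr2 := hhigh r _ hr
    rcases lt_trichotomy r s with hrs | rfl | hrs
    · have := hgap r s hrs
      omega
    · exact hr
    · have := hgap s r hrs
      have hle : i * d ≤ (n + 2) * d := Nat.mul_le_mul_right d (by omega)
      omega
  have e1 : a + (n + 2) * d = a + n * d + 2 * d := by ring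
  have e2 : a + (n + 1) * d = a + n * d + d := by ring
  rw [e1] at hs1 hs2
  have hpen : a + (n + 1) * d ∈ U s := hlarge _ (by omega) (by rw [e2]; omega)
  have hpen1 := hlow s _ hpen
  rw [e2] at hpen1
  have hd : 8 * d < t s := by omega
  have hdown : ∀ j ≤ n + 2, a + (n + 2 - j) * d ∈ U s := by
    intro j
    induction j with
    | zero => exact fun _ => hs
    | succ j ih =>
      intro hj
      have h1 := hlow s _ (ih (by omega))
      have e3 : a + (n + 2 - j) * d = a + (n + 2 - (j + 1)) * d + d := by
        rw [show n + 2 - j = (n + 2 - (j + 1)) + 1 by omega]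
        ring
      rw [e3] at h1
      exact hlarge _ (by omega) (by omega)
  refine ⟨s, fun i hi => ?_⟩
  have := hdown (n + 2 - i) (by omega)
  rwa [show n + 2 - (n + 2 - i) = i by omega] at this

lemma HasDenseAPFree.iUnion {k : ℕ} {μ : ℝ} {U : ℕ → Set ℕ}
    (hU : ∀ r, HasDenseAPFree k μ (U r))
    (hdisj : ∀ r s x, x ∈ U r → x ∈ U s → r = s)
    (hblock : ∀ a d : ℕ, (∀ i < k, a + i * d ∈ ⋃ r, U r) → ∃ r, ∀ i < k, a + i * d ∈ U r) :
    HasDenseAPFree k μ (⋃ r, U r) := by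
  classical
  intro Y hY
  choose! β hβ using fun y (hy : y ∈ Y) => Set.mem_iUnion.1 (hY hy)
  choose Z hZY hZc hZ using fun r => hU r (Y.filter fun y => β y = r) (by
    intro y hy
    obtain ⟨hy1, rfl⟩ := Finset.mem_filter.1 (Finset.mem_coe.1 hy)
    exact hβ y hy1)
  have hZU : ∀ r, ∀ z ∈ Z r, z ∈ U r := by
    intro r z hz
    obtain ⟨h1, rfl⟩ := Finset.mem_filter.1 (hZY r hz)
    exact hβ z h1
  refine ⟨(Y.image β).biUnion Z, ?_, ?_, ?_⟩
  · intro z hz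
    obtain ⟨r, _, hr⟩ := Finset.mem_biUnion.1 hz
    exact (Finset.mem_filter.1 (hZY r hr)).1
  · rw [Finset.card_biUnion, Finset.card_eq_sum_card_image β Y]
    · push_cast
      rw [Finset.mul_sum]
      exact Finset.sum_le_sum fun r _ => hZc r
    · intro r _ s _ hrs
      rw [Function.onFun, Finset.disjoint_left]
      exact fun x hx hx' => hrs (hdisj r s x (hZU r x hx) (hZU s x hx'))
  · rintro ⟨a, d, hd, hAP⟩
    have hAP' : ∀ i < k, ∃ r, a + i * d ∈ Z r := by
      intro i hi
      obtain ⟨r, _, hr⟩ := Finset.mem_biUnion.1 (Finset.mem_coe.1 (hAP i hi))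
      exact ⟨r, hr⟩
    obtain ⟨r, hr⟩ := hblock a d fun i hi => by
      obtain ⟨r, hr⟩ := hAP' i hi
      exact Set.mem_iUnion.2 ⟨r, hZU r _ hr⟩
    refine hZ r ⟨a, d, hd, fun i hi => ?_⟩
    obtain ⟨s, hs⟩ := hAP' i hi
    rw [hdisj r s _ (hr i hi) (hZU s _ hs)]
    exact hs

theorem theorem1p4 (k : ℕ) (hk : 3 ≤ k) (μ : ℝ) (hμ0 : 0 < μ)
    (hμ1 : μ < ((k : ℝ) - 1) / (k : ℝ)) :
    ∃ X : Set ℕ,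
      (∀ r : ℕ, 1 ≤ r → VanDerWaerdenProperty k r X) ∧
      (∀ Y : Finset ℕ, (Y : Set ℕ) ⊆ X →
        ∃ Z : Finset ℕ, Z ⊆ Y ∧ μ * (Y.card : ℝ) ≤ (Z.card : ℝ) ∧
          ¬ ContainsAP k (Z : Set ℕ)) := by
  classical
  choose X hfin hram hdens using fun r : ℕ =>
    exists_finite_ramsey_set (r := r + 1) hk (by omega) hμ1
  choose B hB using fun r => (hfin r).bddAbove
  -- The power of 8 separates the blocks; the sum of bounds makes block `r` shorter than `t r / 8`.
  let t : ℕ → ℕ := fun r => 8 ^ (r + 1) * (1 + ∑ s ∈ Finset.range (r + 1), B s)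
  have hstep : ∀ r, 8 * t r ≤ t (r + 1) := by
    intro r
    have h1 : ∑ s ∈ Finset.range (r + 1), B s ≤ ∑ s ∈ Finset.range (r + 1 + 1), B s := by
      rw [Finset.sum_range_succ _ (r + 1)]
      omega
    calc 8 * t r = 8 ^ (r + 1 + 1) * (1 + ∑ s ∈ Finset.range (r + 1), B s) := by
          simp only [t]; ring
      _ ≤ _ := Nat.mul_le_mul_left _ (by omega)
  have hmono : Monotone t := monotone_nat_of_le_succ fun r => by have := hstep r; omega
  have hgap : ∀ r s, r < s → 8 * t r ≤ t s := fun r s hrs => (hstep r).trans (hmono hrs)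
  have hBt : ∀ r, 8 * (1 + B r) ≤ t r := by
    intro r
    have h1 : B r ≤ ∑ s ∈ Finset.range (r + 1), B s :=
      Finset.single_le_sum (f := B) (fun _ _ => Nat.zero_le _) (Finset.self_mem_range_succ r)
    have h2 : 8 ≤ 8 ^ (r + 1) := Nat.le_self_pow (by omega) 8
    exact Nat.mul_le_mul h2 (by omega)
  have hpos : ∀ r, 0 < t r := fun r => by have := hBt r; omega
  let U : ℕ → Set ℕ := fun r => (fun x => t r + x) '' X r
  have hlow : ∀ r, ∀ x ∈ U r, t r ≤ x := by
    rintro r _ ⟨x, _, rfl⟩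
    exact Nat.le_add_right _ _
  have hhigh : ∀ r, ∀ x ∈ U r, 8 * x < 9 * t r := by
    rintro r _ ⟨x, hx, rfl⟩
    have h1 : x ≤ B r := hB r hx
    have h2 := hBt r
    simp only
    omega
  have hdisj : ∀ r s x, x ∈ U r → x ∈ U s → r = s := by
    intro r s x hr hs
    have h1 := hlow r x hr
    have h2 := hhigh r x hr
    have h3 := hlow s x hs
    have h4 := hhigh s x hs
    have h5 := hpos r
    have h6 := hpos s
    rcases lt_trichotomy r s with h | h | h
    · have := hgap r s h; omega
    · exact h
    · have := hgap s r h; omega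
  refine ⟨⋃ r, U r, fun r hr c => ?_,
    HasDenseAPFree.iUnion (fun r => (hdens r).translate (t r) (by omega)) hdisj
      fun a d => exists_block_of_AP hk hpos hlow hhigh hgap⟩
  obtain ⟨r, rfl⟩ := Nat.exists_eq_add_of_le' hr
  obtain ⟨a, d, hd, hmem, hc⟩ := (hram r).translate (t r)
    fun x => if hx : x ∈ ⋃ r, U r then c ⟨x, hx⟩ else 0
  have hmem' : ∀ i < k, a + i * d ∈ ⋃ r, U r :=
    fun i hi => Set.mem_iUnion.2 ⟨r, hmem i hi⟩
  refine ⟨if hx : a ∈ ⋃ r, U r then c ⟨a, hx⟩ else 0, a, d, hd, fun i hi => ⟨hmem' i hi, ?_⟩⟩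
  exact (dif_pos (hmem' i hi)).symm.trans (hc i hi)
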